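/- \textbf{Setting.} A \emph{network} $\Sigma$ has $n$ scalar subsystems $\dot x_i=\sum_{j\ne i}a_{ij}x_j+b_iu$, $u\in\mathbb R^m$, where each $a_{ij}$ ($i\neq j$) and each entry $b_{i,s}$ is either a free real parameter or fixed to $0$; write $\dot x=Ax+Bu$. Its graph $\mathrm G(\Sigma)$ has input nodes $u_1,\dots,u_m$, state nodes $x_1,\dots,x_n$, an edge $x_j\to x_i$ if $a_{ij}$ is free and an edge $u_s\to x_i$ if $b_{i,s}$ is free. A \emph{stem} is a directed path of distinct nodes from an input node to a state node; a \emph{cycle} is an elementary directed cycle. $\Sigma$ is \emph{input-accessible} if every state node is the end of a stem, and \emph{structurally controllable} if for some values of the free parameters $[B\ AB\ \cdots\ A^{n-1}B]$ has full row rank. $\Sigma$ is an \emph{X-network} if it is input-accessible, not structurally controllable, and there is a set of stems and cycles covering all state nodes which contains a stem and a cycle with a common node, or two distinct cycles with a common node, or two stems from different input nodes with a common node, but does not contain two distinct stems from the same input node. Given orders $\hat n_i\ge 1$ and a set $H$ of \emph{heterogeneous} subsystems, the extended system $\hat\Sigma$ has local states $\hat x_i\in\mathbb R^{\hat n_i}$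 and dynamics $\dot{\hat x}_i=\hat a_i\hat x_i+\sum_{j\neq i}\hat a_{ij}\hat x_j+\hat b_iu$, $\hat y_i=\hat c_i\hat x_i\in\mathbb R$, where the matrix $\hat a_{ij}$ is free if $a_{ij}$ is free and $0$ otherwise, the $s$-th column of $\hat b_i$ is free if $b_{i,s}$ is free and $0$ otherwise, $\hat a_i$ is free if $i\in H$ and $0$ otherwise, and $\hat c_i$ is free if $\hat n_i>1$ and $\hat c_i=1$ if $\hat n_i=1$. With $\hat A,\hat B,\hat C$ the matrices of the whole system and $\hat n=\sum_i\hat n_i$, $\hat\Sigma$ is \emph{structurally output controllable} if for some values of the free parameters $\hat C[\hat B\ \hat A\hat B\ \cdots\ \hat A^{\hat n-1}\hat B]$ has full row rank $n$. It is \emph{homogeneous} if $H=\emptyset$. Let $S$ be the minimum of $|H|$ over all sets $H$ for which the extension with $\hat n_i=1$ for all $i$ is structurally output controllable, let $\hat S$ be the number of $i$ with $\hat n_i>1$ in a structurally output controllable extension $\hat\Sigma$, and let $\Delta=S-\hat S$. \textbf{Corollary 3.} There are X-networks for which $\Delta\to\infty$ as $n\to\infty$. More precisely, for every $n\ge 3$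 there are an X-network $\Sigma_n$ with $n$ subsystems and one input, whose graph consists of a stem and a cycle meeting at exactly one node $z_n$ (a state node), and a structurally output controllable homogeneous extension $\hat\Sigma_n$ of $\Sigma_n$ in which the subsystem of $z_n$ has order two and all others have order one, so that $\hat S=1$; the minimum $S=S(\Sigma_n)$ exists, and $\Delta=S(\Sigma_n)-1\to\infty$ as $n\to\infty$. -/

import Mathlib

namespace NetCtrl

/-! ### Network systems and their graphs -/

/-- A structured network of `n` scalar subsystems with trivial internal dynamics and `m` inputs,
`x_i' = ∑_{j ≠ i} a_{ij} x_j + b_i u`. Here `edge j i` says that the weight `a_{ij}` is a free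
parameter (otherwise it is fixed to zero), `input s i` that the entry `b_{i,s}` is one. -/
structure Network (n m : ℕ) where
  edge : Fin n → Fin n → Prop
  edge_irrefl : ∀ i, ¬ edge i i
  input : Fin m → Fin n → Prop

/-- Nodes of the graph of a network: input nodes `Sum.inl s` and state nodes `Sum.inr i`. -/
abbrev Node (n m : ℕ) := Fin m ⊕ Fin n

variable {n m : ℕ}

/-- The edges of the directed graph of a network, on input and state nodes. -/
def Network.Adj (N : Network n m) : Node n m → Node n m → Prop
  | Sum.inl s, Sum.inr i => N.input s i
  | Sum.inr j, Sum.inr i => N.edge j i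
  | _, Sum.inl _ => False

/-- The list `p` is a stem that originates from the input node `s`: a directed path of pairwise
distinct nodes from that input node to some state node. -/
def Network.IsStemFrom (N : Network n m) (s : Fin m) (p : List (Node n m)) : Prop :=
  p.Nodup ∧ p.IsChain N.Adj ∧ p.head? = some (Sum.inl s) ∧
    ∃ i : Fin n, p.getLast? = some (Sum.inr i)

/-- A stem, from any input node. -/
def Network.IsStem (N : Network n m) (p : List (Node n m)) : Prop :=
  ∃ s, N.IsStemFrom s p

/-- An elementary cycle: a nonempty cyclic sequence of pairwise distinct nodes, each of which has
an edge to the next one, and the last one to the first. -/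
def Network.IsCycle (N : Network n m) (c : Cycle (Node n m)) : Prop :=
  c ≠ Cycle.nil ∧ c.Nodup ∧ c.Chain N.Adj

/-- Every state node is the end node of a stem. -/
def Network.InputAccessible (N : Network n m) : Prop :=
  ∀ i : Fin n, ∃ p, N.IsStem p ∧ p.getLast? = some (Sum.inr i)

/-! ### Structural controllability -/

/-- The controllability matrix `[B, A B, …, A ^ (k - 1) B]`, `k` the dimension of the state. -/
def ctrbMatrix {σ : Type} [Fintype σ] [DecidableEq σ] (A : Matrix σ σ ℝ)
    (B : Matrix σ (Fin m) ℝ) : Matrix σ (Fin (Fintype.card σ) × Fin m) ℝ :=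
  Matrix.of fun x q => (A ^ (q.1 : ℕ) * B) x q.2

/-- Structural controllability: some numerical realization of the free parameters has a
controllability matrix of full row rank. -/
def Network.StructurallyControllable (N : Network n m) : Prop :=
  ∃ (A : Matrix (Fin n) (Fin n) ℝ) (B : Matrix (Fin n) (Fin m) ℝ),
    (∀ i j, ¬ N.edge j i → A i j = 0) ∧
    (∀ i s, ¬ N.input s i → B i s = 0) ∧
    (ctrbMatrix A B).rank = n

/-! ### X-networks -/

/-- There are a set of stems and a set of cycles that together cover the state nodes, such that
some two distinct members of these sets have a common node in one of the ways 1. a stem and a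
cycle, 2. two cycles, 3. two stems from different input nodes, while no two distinct stems
originate from the same input node; and the network is input-accessible, but not structurally
controllable. -/
def Network.IsXNetwork (N : Network n m) : Prop :=
  N.InputAccessible ∧ ¬ N.StructurallyControllable ∧
  ∃ (P : Set (List (Node n m))) (Q : Set (Cycle (Node n m))),
    (∀ p ∈ P, N.IsStem p) ∧ (∀ c ∈ Q, N.IsCycle c) ∧
    (∀ i : Fin n, (∃ p ∈ P, Sum.inr i ∈ p) ∨ (∃ c ∈ Q, Sum.inr i ∈ c)) ∧
    ((∃ p ∈ P, ∃ c ∈ Q, ∃ w, w ∈ p ∧ w ∈ c) ∨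
      (∃ c ∈ Q, ∃ c' ∈ Q, c ≠ c' ∧ ∃ w, w ∈ c ∧ w ∈ c') ∨
      (∃ p ∈ P, ∃ p' ∈ P, ∃ s s', s ≠ s' ∧ N.IsStemFrom s p ∧ N.IsStemFrom s' p' ∧
        ∃ w, w ∈ p ∧ w ∈ p')) ∧
    ¬ (∃ p ∈ P, ∃ p' ∈ P, p ≠ p' ∧ ∃ s, N.IsStemFrom s p ∧ N.IsStemFrom s p')

/-- The graph of the network consists of a stem `p` and a cycle `c` (every node and every edge
belongs to one of the two), and their only common node is the state node of subsystem `z`. -/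
def Network.IsStemCycleAt (N : Network n m) (z : Fin n) : Prop :=
  ∃ (p : List (Node n m)) (c : Cycle (Node n m)),
    N.IsStem p ∧ N.IsCycle c ∧
    (∀ w, w ∈ p ∨ w ∈ c) ∧
    (∀ v w, N.Adj v w → [v, w] <:+: p ∨
      ∃ l : List (Node n m), c = ↑(v :: l) ∧ (l ++ [v]).head? = some w) ∧
    (∀ w, (w ∈ p ∧ w ∈ c) ↔ w = Sum.inr z)

/-! ### Modified local dynamics -/

/-- A choice of local dynamics for the `n` subsystems: the order of every subsystem, and the set of
subsystems with heterogeneous internal dynamics, whose internal matrix has free entries. The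
internal matrix of every other subsystem is zero. -/
structure LocalDynamics (n : ℕ) where
  order : Fin n → ℕ
  order_pos : ∀ i, 1 ≤ order i
  het : Finset (Fin n)

/-- State coordinates of the extended system: the coordinates of all subsystems. -/
abbrev LocalDynamics.State (D : LocalDynamics n) := (i : Fin n) × Fin (D.order i)

/-- All subsystems have trivial internal dynamics. -/
def LocalDynamics.Homogeneous (D : LocalDynamics n) : Prop := D.het = ∅

/-- The number of subsystems of order greater than one. -/
def LocalDynamics.higherOrderCount (D : LocalDynamics n) : ℕ :=
  (Finset.univ.filter fun i => 1 < D.order i).card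

/-- First-order subsystems, heterogeneous exactly on `H`. -/
def LocalDynamics.firstOrder (H : Finset (Fin n)) : LocalDynamics n where
  order := fun _ => 1
  order_pos := fun _ => le_rfl
  het := H

/-- Structural output controllability of the extension of `N` by the local dynamics `D`. The block
`(i, j)` of the state matrix is free if `N` has an edge from `j` to `i`, or if `i = j` is
heterogeneous, and zero otherwise; block `i` of the input matrix is free in column `s` if input `s`
enters subsystem `i` in `N`, and zero there otherwise; the output of subsystem `i` is an arbitrary
linear combination of its coordinates, and its state if it is of order one. Some realization has
to give an output controllability matrix of full row rank. -/
def Network.StructurallyOutputControllable (N : Network n m) (D : LocalDynamics n) : Prop :=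
  ∃ (A : Matrix D.State D.State ℝ) (B : Matrix D.State (Fin m) ℝ) (C : Matrix (Fin n) D.State ℝ),
    (∀ x y : D.State, ¬ N.edge y.1 x.1 → ¬ (x.1 = y.1 ∧ x.1 ∈ D.het) → A x y = 0) ∧
    (∀ (x : D.State) (s : Fin m), ¬ N.input s x.1 → B x s = 0) ∧
    (∀ (i : Fin n) (x : D.State), x.1 ≠ i → C i x = 0) ∧
    (∀ (i : Fin n) (x : D.State), x.1 = i → D.order i = 1 → C i x = 1) ∧
    (C * ctrbMatrix A B).rank = n

/-- The numbers of first-order heterogeneous modifications that can make `N` structurally output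
controllable. -/
def Network.firstOrderCounts (N : Network n m) : Set ℕ :=
  {k | ∃ H : Finset (Fin n), H.card = k ∧
    N.StructurallyOutputControllable (LocalDynamics.firstOrder H)}

/-- The minimum number `S` of first-order heterogeneous modifications. -/
noncomputable def Network.minFirstOrder (N : Network n m) : ℕ := sInf N.firstOrderCounts

/-- The index `Δ = S - Ŝ`, with `Ŝ` the number of higher-order subsystems in `D`. -/
noncomputable def Network.advantage (N : Network n m) (D : LocalDynamics n) : ℤ :=
  (N.minFirstOrder : ℤ) - (D.higherOrderCount : ℤ)

end NetCtrl

namespace NetCtrl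

open Matrix

/-! ### Rank criteria for controllability matrices -/

/-! Write q for `armLength n`. From the center 0 leave two arms: the cycle nodes 1, …, q, closed by
the edge from q to 0, and a tail with n - 1 - q ≥ q nodes.

Lower bound on S: if neither a on the first arm nor b on the tail is heterogeneous, the initial
segments of the arms ending at a and b form a dilation, since their rows meet only the center and
the segments without a and b, one column too few (`stemCycle_rank_ne`). So H must contain one whole
arm, and S ≥ q, which tends to infinity.

One second-order subsystem suffices because two copies of the center unroll the graph into a single
path: first copy, cycle nodes, second copy, tail. The shift along this path, driven at its start,
reaches every state.

S is a genuine minimum because H = `univ` works: a triangular realization with distinct eigenvalues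
has a binomial left eigenbasis, and the controllability matrix becomes a Vandermonde matrix. -/

theorem rank_eq_iff_vecMul_eq_zero {ι : Type} [Fintype ι] {n : ℕ} (M : Matrix (Fin n) ι ℝ) :
    M.rank = n ↔ ∀ v : Fin n → ℝ, v ᵥ* M = 0 → v = 0 := by
  rw [Matrix.rank_eq_finrank_span_row, eq_comm]
  nth_rw 1 [← Fintype.card_fin n]
  rw [← Set.finrank, ← linearIndependent_iff_card_eq_finrank_span (b := M.row),
    ← Matrix.vecMul_injective_iff]
  exact injective_iff_map_eq_zero M.vecMulLinear

theorem vecMul_ctrbMatrix_eq_zero {n m : ℕ} {A : Matrix (Fin n) (Fin n) ℝ}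
    {B : Matrix (Fin n) (Fin m) ℝ} {v : Fin n → ℝ} (hA : v ᵥ* A = 0) (hB : v ᵥ* B = 0) :
    v ᵥ* ctrbMatrix A B = 0 := by
  have h (k : ℕ) : v ᵥ* (A ^ k * B) = 0 := by
    cases k with
    | zero => simpa using hB
    | succ k => rw [pow_succ', Matrix.mul_assoc, ← Matrix.vecMul_vecMul, hA, Matrix.zero_vecMul]
  funext q
  exact congrFun (h q.1) q.2

/-- A dilation obstructs controllability: the rows in `S` meet too few columns. -/
theorem rank_ctrbMatrix_ne_of_dilation {n m : ℕ} {A : Matrix (Fin n) (Fin n) ℝ}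
    {B : Matrix (Fin n) (Fin m) ℝ} {S T : Finset (Fin n)} (hST : T.card < S.card)
    (hA : ∀ x ∈ S, ∀ y ∉ T, A x y = 0) (hB : ∀ x ∈ S, ∀ s, B x s = 0) :
    (ctrbMatrix A B).rank ≠ n := by
  intro hrank
  -- This block has more rows than columns, hence a nonzero left kernel vector; extended by zero, it
  -- annihilates both `A` and `B`.
  let M : Matrix S T ℝ := A.submatrix (↑) (↑)
  obtain ⟨w, hw, hw0⟩ := (Submodule.ne_bot_iff _).1
    (LinearMap.ker_ne_bot_of_finrank_lt (f := M.vecMulLinear) (by simpa using hST))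
  rw [LinearMap.mem_ker, Matrix.vecMulLinear_apply] at hw
  let v : Fin n → ℝ := fun x => if h : x ∈ S then w ⟨x, h⟩ else 0
  have hv (f : Fin n → ℝ) : v ⬝ᵥ f = ∑ x : S, w x * f x := by
    rw [dotProduct, ← Finset.sum_subset S.subset_univ, ← Finset.sum_coe_sort]
    · exact Finset.sum_congr rfl fun x _ => by simp [v]
    · intro x _ hx
      simp [v, hx]
  have hvA : v ᵥ* A = 0 := by
    funext y
    rw [Matrix.vecMul, hv]
    by_cases hy : y ∈ T
    · exact congrFun hw ⟨y, hy⟩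
    · exact Finset.sum_eq_zero fun x _ => by rw [hA x x.2 y hy, mul_zero]
  have hvB : v ᵥ* B = 0 := by
    funext s
    rw [Matrix.vecMul, hv]
    exact Finset.sum_eq_zero fun x _ => by rw [hB x x.2 s, mul_zero]
  have h0 := (rank_eq_iff_vecMul_eq_zero _).1 hrank v (vecMul_ctrbMatrix_eq_zero hvA hvB)
  refine hw0 (funext fun x => ?_)
  simpa [v] using congrFun h0 x

/-- A pair with left eigenvectors for distinct eigenvalues, none orthogonal to the input vector,
is controllable. -/
theorem rank_ctrbMatrix_of_left_eigenvectors {n : ℕ} {A V : Matrix (Fin n) (Fin n) ℝ}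
    {B : Matrix (Fin n) (Fin 1) ℝ} {d : Fin n → ℝ} (hd : Function.Injective d)
    (hA : V * A = Matrix.diagonal d * V) (hB : ∀ i, (V * B) i 0 = 1) :
    (ctrbMatrix A B).rank = n := by
  have hpow (k : ℕ) : V * A ^ k = Matrix.diagonal d ^ k * V := by
    induction k with
    | zero => simp
    | succ k ih => rw [pow_succ, ← Matrix.mul_assoc, ih, Matrix.mul_assoc, hA, pow_succ,
        Matrix.mul_assoc]
  -- Row i of `V * A ^ k * B` is `d i ^ k`, because `V * B` is constantly one.
  have hV : V * ctrbMatrix A B = (Matrix.vandermonde d).submatrix (Equiv.refl _)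
      ((Equiv.prodUnique (Fin (Fintype.card (Fin n))) (Fin 1)).trans
        (finCongr (Fintype.card_fin n))) := by
    ext i ⟨k, s⟩
    obtain rfl := Subsingleton.elim s 0
    change (V * (A ^ (k : ℕ) * B)) i 0 = d i ^ (k : ℕ)
    rw [← Matrix.mul_assoc, hpow, Matrix.mul_assoc, Matrix.diagonal_pow, Matrix.diagonal_mul, hB]
    simp
  refine le_antisymm ((Matrix.rank_le_card_height _).trans_eq (Fintype.card_fin n)) ?_
  calc n = (Matrix.vandermonde d).rank := by
        rw [Matrix.rank_of_isUnit, Fintype.card_fin]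
        rw [Matrix.isUnit_iff_isUnit_det, isUnit_iff_ne_zero]
        exact Matrix.det_vandermonde_ne_zero_iff.2 hd
    _ = (V * ctrbMatrix A B).rank := by rw [hV, Matrix.rank_submatrix]
    _ ≤ _ := Matrix.rank_mul_le_right _ _

/-! ### First-order local dynamics -/

/-- With first-order subsystems, output controllability is controllability of the network with
the heterogeneous diagonal entries freed. -/
theorem Network.structurallyOutputControllable_firstOrder_iff {n m : ℕ} (N : Network n m)
    (H : Finset (Fin n)) :
    N.StructurallyOutputControllable (LocalDynamics.firstOrder H) ↔
      ∃ (A : Matrix (Fin n) (Fin n) ℝ) (B : Matrix (Fin n) (Fin m) ℝ),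
        (∀ i j, ¬ N.edge j i → ¬ (i = j ∧ i ∈ H) → A i j = 0) ∧
        (∀ i s, ¬ N.input s i → B i s = 0) ∧ (ctrbMatrix A B).rank = n := by
  let D := LocalDynamics.firstOrder H
  let e : D.State ≃ Fin n := Equiv.sigmaUnique (Fin n) fun _ => Fin 1
  have key (A : Matrix D.State D.State ℝ) (B : Matrix D.State (Fin m) ℝ)
      (C : Matrix (Fin n) D.State ℝ) (hC : ∀ i x, x.1 ≠ i → C i x = 0)
      (hC1 : ∀ i x, x.1 = i → D.order i = 1 → C i x = 1) :
      (C * ctrbMatrix A B).rank =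
        (ctrbMatrix (A.submatrix e.symm e.symm) (B.submatrix e.symm id)).rank := by
    have hpow (k : ℕ) : A.submatrix e.symm e.symm ^ k = (A ^ k).submatrix e.symm e.symm := by
      induction k with
      | zero => simp
      | succ k ih => rw [pow_succ, ih, pow_succ, Matrix.submatrix_mul_equiv]
    -- With one coordinate per subsystem, `C` is forced to be the relabelling `e`, so it only
    -- reindexes rows.
    have h : C * ctrbMatrix A B =
        (ctrbMatrix (A.submatrix e.symm e.symm) (B.submatrix e.symm id)).submatrix
          (Equiv.refl _) ((finCongr (Fintype.card_congr e)).prodCongr (Equiv.refl _)) := by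
      ext i q
      rw [Matrix.mul_apply, Fintype.sum_eq_single (e.symm i)]
      · rw [hC1 i _ (e.apply_symm_apply i) rfl, one_mul]
        simp [ctrbMatrix, hpow, Matrix.submatrix_mul_equiv]
      · intro x hx
        rw [hC i x fun h => hx (by rw [← h]; exact (e.symm_apply_apply x).symm), zero_mul]
    rw [h, Matrix.rank_submatrix]
  constructor
  · rintro ⟨A, B, C, hA, hB, hC, hC1, hr⟩
    exact ⟨_, _, fun i j h h' => hA _ _ h h', fun i s h => hB _ _ h, (key A B C hC hC1) ▸ hr⟩
  · rintro ⟨A, B, hA, hB, hr⟩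
    refine ⟨A.submatrix e e, B.submatrix e id, fun i x => if x.1 = i then 1 else 0,
      fun x y h h' => hA _ _ h h', fun x s h => hB _ _ h, fun i x h => if_neg h,
      fun i x h _ => if_pos h, ?_⟩
    rw [key _ _ _ (fun i x h => if_neg h) fun i x h _ => if_pos h]
    simpa using hr

/-! ### A stem and a cycle that meet at one node -/

/-- The number of nodes of the cycle other than the common node. -/
def armLength (n : ℕ) : ℕ := (n - 3) / 2 + 1

/-- The input enters node `0`, which starts both the tail `armLength n + 1, …, n - 1` of the stem
and the cycle `0, 1, …, armLength n`. -/
def stemCycle (n : ℕ) : Network n 1 where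
  edge j i := ((i : ℕ) = j + 1 ∧ (i : ℕ) ≠ armLength n + 1) ∨
    ((j : ℕ) = 0 ∧ (i : ℕ) = armLength n + 1) ∨ ((j : ℕ) = armLength n ∧ (i : ℕ) = 0)
  edge_irrefl i := by
    unfold armLength
    omega
  input _ i := (i : ℕ) = 0

/-- Node `0` is of order two, and all subsystems are homogeneous. -/
def doubledCenter (n : ℕ) : LocalDynamics n where
  order i := if (i : ℕ) = 0 then 2 else 1
  order_pos i := by split <;> omega
  het := ∅

theorem armLength_pos (n : ℕ) : 1 ≤ armLength n := by
  unfold armLength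
  omega

/-- This makes the tail at least as long as the cycle arm, so filling either arm costs at least
`armLength n`. -/
theorem two_mul_armLength_lt {n : ℕ} (hn : 3 ≤ n) : 2 * armLength n < n := by
  unfold armLength
  omega

theorem tendsto_armLength : Filter.Tendsto armLength Filter.atTop Filter.atTop :=
  Filter.tendsto_atTop.2 fun k => Filter.eventually_atTop.2
    ⟨2 * k + 3, fun n hn => by unfold armLength; omega⟩

/-- Nodes without internal dynamics on both arms form a dilation. -/
theorem stemCycle_rank_ne {n : ℕ} {H : Finset (Fin n)} {A : Matrix (Fin n) (Fin n) ℝ}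
    {B : Matrix (Fin n) (Fin 1) ℝ}
    (hA : ∀ i j, ¬ (stemCycle n).edge j i → ¬ (i = j ∧ i ∈ H) → A i j = 0)
    (hB : ∀ i s, ¬ (stemCycle n).input s i → B i s = 0) {a b : Fin n}
    (ha : 1 ≤ (a : ℕ)) (ha' : (a : ℕ) ≤ armLength n) (hb : armLength n < (b : ℕ))
    (haH : a ∉ H) (hbH : b ∉ H) : (ctrbMatrix A B).rank ≠ n := by
  let S : Finset (Fin n) := Finset.univ.filter fun x =>
    (1 ≤ (x : ℕ) ∧ (x : ℕ) ≤ a) ∨ (armLength n < (x : ℕ) ∧ (x : ℕ) ≤ b)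
  let z : Fin n := ⟨0, a.pos⟩
  have hmem (x : Fin n) : x ∈ S ↔
      (1 ≤ (x : ℕ) ∧ (x : ℕ) ≤ a) ∨ (armLength n < (x : ℕ) ∧ (x : ℕ) ≤ b) := by
    simp [S]
  have haS : a ∈ S := (hmem a).2 (by omega)
  have hbS : b ∈ S.erase a := by
    rw [Finset.mem_erase, hmem, Ne, Fin.ext_iff]
    omega
  -- Columns `a` and `b` drop out: their successors on the arms lie outside `S`, and they have no
  -- self-loops. Two columns are lost and only the center is gained.
  refine rank_ctrbMatrix_ne_of_dilation (S := S) (T := insert z ((S.erase a).erase b)) ?_ ?_ ?_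
  · have h1 := Finset.card_erase_of_mem haS
    have h2 := Finset.card_erase_of_mem hbS
    have h3 := Finset.card_insert_le z ((S.erase a).erase b)
    have h4 := Finset.card_pos.2 ⟨b, hbS⟩
    omega
  · intro x hx y hy
    rw [hmem] at hx
    simp only [Finset.mem_insert, Finset.mem_erase, hmem, not_or, not_and, z, Fin.ext_iff, Ne] at hy
    refine hA x y ?_ ?_
    · simp only [stemCycle]
      omega
    · rintro ⟨rfl, hxH⟩
      have h1 : (x : ℕ) ≠ a := fun h => haH (Fin.ext h ▸ hxH)
      have h2 : (x : ℕ) ≠ b := fun h => hbH (Fin.ext h ▸ hxH)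
      omega
  · intro x hx s
    rw [hmem] at hx
    refine hB x s ?_
    simp only [stemCycle]
    omega

theorem stemCycle_not_structurallyControllable {n : ℕ} (hn : 3 ≤ n) :
    ¬ (stemCycle n).StructurallyControllable := by
  rintro ⟨A, B, hA, hB, hr⟩
  have h1 := armLength_pos n
  have h2 := two_mul_armLength_lt hn
  exact stemCycle_rank_ne (H := (∅ : Finset (Fin n))) (a := ⟨1, by omega⟩) (b := ⟨armLength n + 1, by omega⟩)
    (fun i j h _ => hA i j h) hB le_rfl h1 (Nat.lt_succ_self _) (Finset.notMem_empty _)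
    (Finset.notMem_empty _) hr

theorem armLength_le_of_mem_firstOrderCounts {n k : ℕ} (hn : 3 ≤ n)
    (hk : k ∈ (stemCycle n).firstOrderCounts) : armLength n ≤ k := by
  obtain ⟨H, rfl, hH⟩ := hk
  obtain ⟨A, B, hA, hB, hr⟩ := ((stemCycle n).structurallyOutputControllable_firstOrder_iff H).1 hH
  have h1 := armLength_pos n
  have h2 := two_mul_armLength_lt hn
  -- A set with fewer than `armLength n` elements misses a node on each arm.
  by_contra! hlt
  obtain ⟨a, ha, haH⟩ := Finset.exists_mem_notMem_of_card_lt_card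
    (s := H) (t := Finset.Icc ⟨1, by omega⟩ ⟨armLength n, by omega⟩) (by simpa using hlt)
  obtain ⟨b, hb, hbH⟩ := Finset.exists_mem_notMem_of_card_lt_card
    (s := H) (t := Finset.Ici ⟨armLength n + 1, by omega⟩) (by rw [Fin.card_Ici]; simp; omega)
  rw [Finset.mem_Icc, Fin.le_def, Fin.le_def] at ha
  rw [Finset.mem_Ici, Fin.le_def] at hb
  exact stemCycle_rank_ne hA hB ha.1 ha.2 hb haH hbH hr

/-! ### Controllable realizations -/

theorem stemCycle_structurallyOutputControllable_univ {n : ℕ} (hn : 3 ≤ n) :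
    (stemCycle n).StructurallyOutputControllable (LocalDynamics.firstOrder Finset.univ) := by
  rw [Network.structurallyOutputControllable_firstOrder_iff]
  have hq := armLength_pos n
  -- `dep` is the distance from the center and `sgn` tells the arms apart, so the eigenvalues are 0
  -- at the center, positive on the cycle arm and negative on the tail. The closing edge of the
  -- cycle gets weight zero in `A`.
  let dep (i : Fin n) : ℕ := if (i : ℕ) ≤ armLength n then i else i - armLength n
  let sgn (i : Fin n) : ℝ := if (i : ℕ) ≤ armLength n then 1 else -1
  let A : Matrix (Fin n) (Fin n) ℝ := fun j p =>
    if j = p ∨ ((j : ℕ) = p + 1 ∧ (j : ℕ) ≠ armLength n + 1) ∨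
      ((p : ℕ) = 0 ∧ (j : ℕ) = armLength n + 1) then sgn j * dep j else 0
  let B : Matrix (Fin n) (Fin 1) ℝ := fun i _ => if (i : ℕ) = 0 then 1 else 0
  let V : Matrix (Fin n) (Fin n) ℝ := fun i j =>
    if (j : ℕ) = 0 ∨ ((j : ℕ) ≤ i ∧ ((i : ℕ) ≤ armLength n ↔ (j : ℕ) ≤ armLength n)) then
      ((dep i).choose (dep j) : ℝ) else 0
  refine ⟨A, B, ?_, fun i s h => if_neg h, ?_⟩
  · intro i j h h'
    refine if_neg fun hij => ?_
    rcases hij with rfl | hij | hij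
    · exact h' ⟨rfl, Finset.mem_univ _⟩
    · exact h (Or.inl hij)
    · exact h (Or.inr (Or.inl hij))
  refine rank_ctrbMatrix_of_left_eigenvectors (V := V) (d := fun i => sgn i * dep i) ?_ ?_ ?_
  · intro i j hij
    simp only [sgn, dep] at hij
    have key : ∀ {x y : Fin n}, (x : ℕ) ≤ armLength n → ¬ (y : ℕ) ≤ armLength n →
        (1 : ℝ) * ((x : ℕ) : ℝ) ≠ -1 * (((y : ℕ) - armLength n : ℕ) : ℝ) := by
      intro x y hx hy h
      have h' : ((x : ℕ) : ℝ) + (((y : ℕ) - armLength n : ℕ) : ℝ) = 0 := by linarith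
      norm_cast at h'
      omega
    by_cases hi : (i : ℕ) ≤ armLength n <;> by_cases hj : (j : ℕ) ≤ armLength n <;>
      simp only [hi, hj, if_true, if_false] at hij
    · simpa [Fin.ext_iff] using hij
    · exact absurd hij (key hi hj)
    · exact absurd hij.symm (key hj hi)
    · rw [neg_one_mul, neg_one_mul, neg_inj, Nat.cast_inj] at hij
      exact Fin.ext (by omega)
  · ext i p
    rw [Matrix.diagonal_mul, Matrix.mul_apply]
    by_cases hp : (p : ℕ) = 0 ∨
        ((p : ℕ) ≤ i ∧ ((i : ℕ) ≤ armLength n ↔ (p : ℕ) ≤ armLength n))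
    · rcases (show (p : ℕ) ≤ i by omega).eq_or_lt with hpi | hpi
      · obtain rfl := Fin.ext hpi
        rw [Fintype.sum_eq_single p]
        · simp only [A, true_or, if_true]
          ring
        · intro j hj
          rw [Ne, Fin.ext_iff] at hj
          simp only [V, A, Fin.ext_iff]
          rw [ite_mul, mul_ite]
          split_ifs <;> first | omega | simp
      -- `c` is the successor of `p` on the way to `i`; only `p` and `c` contribute to the sum.
      · obtain ⟨c, hc⟩ : ∃ c : Fin n, (c : ℕ) =
            if (p : ℕ) = 0 ∧ armLength n < (i : ℕ) then armLength n + 1 else p + 1 :=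
          ⟨⟨if (p : ℕ) = 0 ∧ armLength n < (i : ℕ) then armLength n + 1 else p + 1,
            by split_ifs <;> omega⟩, rfl⟩
        have hci : (c : ℕ) ≤ i ∧ ((i : ℕ) ≤ armLength n ↔ (c : ℕ) ≤ armLength n) := by
          split_ifs at hc <;> omega
        have hpc : p ≠ c := by
          rw [Ne, Fin.ext_iff]
          split_ifs at hc <;> omega
        have hdep : dep c = dep p + 1 := by
          simp only [dep]
          split_ifs at hc ⊢ <;> omega
        have hsc : sgn c = sgn i := by simp only [sgn, hci.2]
        have hsp : sgn p * dep p = sgn i * dep p := by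
          rcases hp with hp | hp
          · simp [dep, hp]
          · simp only [sgn, hp.2]
        have hle : dep p ≤ dep i := by
          simp only [dep]
          split_ifs <;> omega
        rw [Fintype.sum_eq_add p c hpc]
        · have hAc : A c p = sgn c * dep c := if_pos (by split_ifs at hc <;> omega)
          have hAp : A p p = sgn p * dep p := if_pos (Or.inl rfl)
          have hVp : V i p = (dep i).choose (dep p) := if_pos hp
          have hVc : V i c = (dep i).choose (dep c) := if_pos (Or.inr hci)
          -- With d = `dep i` and e = `dep p`, the eigenvector equation is e·C(d, e) + (e + 1)·C(d,
          -- e + 1) = d·C(d, e).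
          have hch := congrArg (Nat.cast (R := ℝ)) (Nat.choose_succ_right_eq (dep i) (dep p))
          push_cast [Nat.cast_sub hle] at hch
          rw [hAc, hAp, hVp, hVc, hsc, hsp, hdep]
          push_cast
          linear_combination sgn i * hch
        · rintro j ⟨hjp, hjc⟩
          rw [Ne, Fin.ext_iff] at hjp hjc
          simp only [V, A, Fin.ext_iff]
          rw [ite_mul, mul_ite]
          split_ifs at hc ⊢ <;> first | omega | simp
    · have hVp : V i p = 0 := if_neg hp
      rw [hVp, mul_zero]
      refine Finset.sum_eq_zero fun j _ => ?_
      simp only [V, A, Fin.ext_iff]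
      rw [ite_mul, mul_ite]
      split_ifs <;> first | omega | simp
  · intro i
    rw [Matrix.mul_apply, Fintype.sum_eq_single ⟨0, by omega⟩]
    · simp [V, B, dep]
    · intro j hj
      rw [Ne, Fin.ext_iff] at hj
      simp only [B]
      rw [if_neg hj, mul_zero]

/-- The position on the walk that starts at the center, runs once through the cycle back to the
center, and then along the tail. -/
def doubledCenterPos {n : ℕ} (x : (doubledCenter n).State) : ℕ :=
  if (x.1 : ℕ) = 0 then (if (x.2 : ℕ) = 0 then 0 else armLength n + 1)
  else if (x.1 : ℕ) ≤ armLength n then x.1 else x.1 + 1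

theorem doubledCenterPos_injective (n : ℕ) :
    Function.Injective (doubledCenterPos (n := n)) := by
  rintro ⟨i, a⟩ ⟨j, b⟩ h
  have ha : (a : ℕ) < if (i : ℕ) = 0 then 2 else 1 := a.2
  have hb : (b : ℕ) < if (j : ℕ) = 0 then 2 else 1 := b.2
  simp only [doubledCenterPos] at h
  have h1 : (i : ℕ) = j := by grind
  obtain rfl := Fin.ext h1
  have h2 : (a : ℕ) = b := by grind
  rw [Fin.ext h2]

theorem exists_doubledCenterPos_eq {n k : ℕ} (hn : 3 ≤ n) (hk : k ≤ n) :
    ∃ x : (doubledCenter n).State, doubledCenterPos x = k := by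
  have h1 := armLength_pos n
  have h2 := two_mul_armLength_lt hn
  rcases Nat.lt_trichotomy k (armLength n + 1) with h | h | h
  · refine ⟨⟨⟨k, by omega⟩, ⟨0, (doubledCenter n).order_pos _⟩⟩, ?_⟩
    simp only [doubledCenterPos]
    grind
  · refine ⟨⟨⟨0, by omega⟩, ⟨1, by simp [doubledCenter]⟩⟩, ?_⟩
    simp only [doubledCenterPos]
    grind
  · refine ⟨⟨⟨k - 1, by omega⟩, ⟨0, (doubledCenter n).order_pos _⟩⟩, ?_⟩
    simp only [doubledCenterPos]
    grind

theorem stemCycle_structurallyOutputControllable_doubledCenter {n : ℕ} (hn : 3 ≤ n) :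
    (stemCycle n).StructurallyOutputControllable (doubledCenter n) := by
  have hq := armLength_pos n
  let A : Matrix (doubledCenter n).State (doubledCenter n).State ℝ := fun x y =>
    if doubledCenterPos x = doubledCenterPos y + 1 then 1 else 0
  let B : Matrix (doubledCenter n).State (Fin 1) ℝ := fun x _ =>
    if doubledCenterPos x = 0 then 1 else 0
  -- The second coordinate of the center only relays the walk into the tail and is not read.
  let C : Matrix (Fin n) (doubledCenter n).State ℝ := fun i x =>
    if x.1 = i ∧ (x.2 : ℕ) = 0 then 1 else 0
  -- The input is a unit impulse at position 0, moved one position by each factor `A`; positions run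
  -- from 0 to n.
  have hpow (k : ℕ) (hk : k ≤ n) (x : (doubledCenter n).State) (s : Fin 1) :
      (A ^ k * B) x s = if doubledCenterPos x = k then 1 else 0 := by
    induction k generalizing x with
    | zero => rw [pow_zero, Matrix.one_mul]
    | succ k ih =>
      obtain ⟨y, rfl⟩ := exists_doubledCenterPos_eq hn (Nat.le_of_succ_le hk)
      rw [pow_succ', Matrix.mul_assoc, Matrix.mul_apply, Fintype.sum_eq_single y]
      · rw [ih (Nat.le_of_succ_le hk)]
        simp [A]
      · intro x' hx'
        rw [ih (Nat.le_of_succ_le hk), if_neg (fun h => hx' (doubledCenterPos_injective n h)),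
          mul_zero]
  refine ⟨A, B, C, ?_, ?_, ?_, ?_, ?_⟩
  · rintro ⟨i, a⟩ ⟨j, b⟩ h -
    refine if_neg fun h' => h ?_
    simp only [doubledCenterPos] at h'
    simp only [stemCycle]
    grind
  · rintro ⟨i, a⟩ s h
    refine if_neg fun h' => h ?_
    simp only [doubledCenterPos] at h'
    simp only [stemCycle]
    grind
  · exact fun i x h => if_neg fun h' => h h'.1
  · rintro i ⟨j, a⟩ rfl h
    exact if_pos ⟨rfl, Nat.lt_one_iff.1 (h ▸ a.2)⟩
  · rw [rank_eq_iff_vecMul_eq_zero]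
    intro v hv
    funext i
    let x : (doubledCenter n).State := ⟨i, ⟨0, (doubledCenter n).order_pos i⟩⟩
    have hx : doubledCenterPos x ≤ n := by
      have := i.2
      simp only [doubledCenterPos, x]
      grind
    have hcard : n < Fintype.card (doubledCenter n).State := by
      rw [Fintype.card_sigma]
      simp only [Fintype.card_fin]
      calc n < ∑ i : Fin n, (1 + if i = ⟨0, by omega⟩ then 1 else 0) := by
            rw [Finset.sum_add_distrib]
            simp
        _ ≤ _ := Finset.sum_le_sum fun i _ => by
            simp only [doubledCenter, Fin.ext_iff]
            split <;> rfl
    have h := congrFun hv (⟨doubledCenterPos x, hx.trans_lt hcard⟩, 0)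
    rw [← Matrix.vecMul_vecMul] at h
    change ∑ y, (v ᵥ* C) y * (A ^ doubledCenterPos x * B) y 0 = 0 at h
    rw [Fintype.sum_eq_single x] at h
    · rw [hpow _ hx, if_pos rfl, mul_one] at h
      change ∑ j, v j * C j x = 0 at h
      rw [Fintype.sum_eq_single i] at h
      · simpa [C, x] using h
      · intro j hj
        simp [C, x, hj.symm]
    · intro y hy
      rw [hpow _ hx, if_neg fun h => hy (doubledCenterPos_injective n h), mul_zero]

/-! ### The graph -/

theorem stemCycle_inputAccessible (n : ℕ) : (stemCycle n).InputAccessible := by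
  -- The bound on the visited nodes makes an appended node automatically new. Strong induction is
  -- needed since node `armLength n + 1` is entered from 0.
  suffices h : ∀ (k : ℕ) (hk : k < n), ∃ p, (stemCycle n).IsStem p ∧
      p.getLast? = some (Sum.inr ⟨k, hk⟩) ∧ ∀ j : Fin n, Sum.inr j ∈ p → (j : ℕ) ≤ k by
    intro i
    obtain ⟨p, hp, hl, -⟩ := h i i.2
    exact ⟨p, hp, hl⟩
  intro k
  induction k using Nat.strong_induction_on with
  | _ k ih =>
    intro hk
    rcases Nat.eq_zero_or_pos k with rfl | hpos
    · refine ⟨[Sum.inl 0, Sum.inr ⟨0, hk⟩], ⟨0, ?_, ?_, rfl, _, rfl⟩, rfl, ?_⟩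
      · simp
      · simp [Network.Adj, stemCycle]
      · simp
    · obtain ⟨j, hj, hedge⟩ : ∃ j, ∃ hj : j < k,
          (stemCycle n).edge ⟨j, hj.trans hk⟩ ⟨k, hk⟩ := by
        by_cases h : k = armLength n + 1
        · exact ⟨0, hpos, Or.inr (Or.inl ⟨rfl, h⟩)⟩
        · exact ⟨k - 1, by omega, Or.inl ⟨by simp only; omega, h⟩⟩
      obtain ⟨p, ⟨s, hnd, hch, hhead, -⟩, hl, hle⟩ := ih j hj (hj.trans hk)
      refine ⟨p ++ [Sum.inr ⟨k, hk⟩], ⟨s, ?_, ?_, ?_, ⟨k, hk⟩, ?_⟩, ?_, ?_⟩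
      · rw [List.nodup_append]
        refine ⟨hnd, by simp, ?_⟩
        rintro a ha b hb rfl
        rw [List.mem_singleton] at hb
        subst hb
        exact absurd (hle _ ha) (by simp only; omega)
      · rw [List.isChain_append]
        refine ⟨hch, by simp, ?_⟩
        intro a ha b hb
        rw [hl] at ha
        simp only [Option.mem_def, Option.some.injEq, List.head?_cons] at ha hb
        subst ha hb
        exact hedge
      · rw [List.head?_append, hhead]
        rfl
      · simp
      · simp
      · intro i hi
        rcases List.mem_append.1 hi with hi | hi
        · exact (hle i hi).trans hj.le
        · simp only [List.mem_singleton, Sum.inr.injEq] at hi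
          rw [hi]

/-- Rotating a cycle to start at a chosen node exposes the edge that leaves this node. -/
theorem cycle_coe_map_range_eq {α : Type*} (f : ℕ → α) {j l : ℕ} (hj : j < l) :
    ((List.range l).map f : Cycle α) =
      ((f j :: ((List.range' (j + 1) (l - (j + 1))).map f ++ (List.range j).map f) : List α) :
        Cycle α) := by
  rw [Cycle.coe_eq_coe]
  obtain ⟨r, rfl⟩ := Nat.exists_eq_add_of_lt hj
  have h : List.range (j + r + 1) = List.range j ++ j :: List.range' (j + 1) r := by
    rw [List.range_eq_range', List.range_eq_range', ← List.range'_succ, add_assoc,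
      ← List.range'_append_1, zero_add]
  rw [h, List.map_append, List.map_cons, show j + r + 1 - (j + 1) = r by omega]
  exact List.isRotated_append

theorem pair_infix_map_range' {α : Type*} (f : ℕ → α) {a l k : ℕ} (h : k + 1 < l) :
    [f (a + k), f (a + k + 1)] <:+: (List.range' a l).map f := by
  obtain ⟨r, rfl⟩ := Nat.exists_eq_add_of_le (show k + 2 ≤ l from h)
  refine ⟨(List.range' a k).map f, (List.range' (a + k + 2) r).map f, ?_⟩
  rw [add_assoc k 2 r, ← List.range'_append_1, add_comm 2 r, List.range'_succ, List.range'_succ]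
  simp [add_assoc]

section Graph

variable {n : ℕ} (hn : 3 ≤ n)

/-- The state node with a given number. -/
def stateNode (k : ℕ) : Node n 1 :=
  Sum.inr ⟨k % n, Nat.mod_lt _ (by omega)⟩

def stemList : List (Node n 1) :=
  Sum.inl 0 :: stateNode hn 0 ::
    (List.range' (armLength n + 1) (n - (armLength n + 1))).map (stateNode hn)

def cycleNodes : Cycle (Node n 1) :=
  ((List.range (armLength n + 1)).map (stateNode hn) : List (Node n 1))

theorem stateNode_val (i : Fin n) : stateNode hn i = Sum.inr i := by
  simp [stateNode, Nat.mod_eq_of_lt i.2]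

theorem stateNode_injOn {j k : ℕ} (hj : j < n) (hk : k < n)
    (h : stateNode hn j = stateNode hn k) : j = k := by
  simpa [stateNode, Nat.mod_eq_of_lt hj, Nat.mod_eq_of_lt hk] using h

theorem adj_stateNode {j k : ℕ} (hj : j < n) (hk : k < n) :
    (stemCycle n).Adj (stateNode hn j) (stateNode hn k) ↔
      (k = j + 1 ∧ k ≠ armLength n + 1) ∨ (j = 0 ∧ k = armLength n + 1) ∨
        (j = armLength n ∧ k = 0) := by
  simp only [stateNode, Network.Adj, stemCycle, Nat.mod_eq_of_lt hj, Nat.mod_eq_of_lt hk]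

theorem inr_mem_stemList (i : Fin n) :
    Sum.inr i ∈ stemList hn ↔ (i : ℕ) = 0 ∨ armLength n < (i : ℕ) := by
  have := i.2
  rw [← stateNode_val hn]
  simp only [stemList, List.mem_cons, List.mem_map, List.mem_range'_1]
  constructor
  · rintro (h | h | ⟨k, hk, h⟩)
    · cases h
    · exact Or.inl (stateNode_injOn hn i.2 (by omega) h)
    · have := stateNode_injOn hn (by omega) i.2 h
      omega
  · rintro (h | h)
    · exact Or.inr (Or.inl (by rw [h]))
    · exact Or.inr (Or.inr ⟨i, by omega, rfl⟩)

theorem inr_mem_cycleNodes (i : Fin n) :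
    Sum.inr i ∈ cycleNodes hn ↔ (i : ℕ) ≤ armLength n := by
  have := two_mul_armLength_lt hn
  rw [← stateNode_val hn]
  simp only [cycleNodes, Cycle.mem_coe_iff, List.mem_map, List.mem_range]
  constructor
  · rintro ⟨k, hk, h⟩
    have := stateNode_injOn hn (by omega) i.2 h
    omega
  · exact fun h => ⟨i, by omega, rfl⟩

theorem inl_mem_stemList (s : Fin 1) : Sum.inl s ∈ stemList hn := by
  rw [Subsingleton.elim s 0]
  exact List.mem_cons_self

theorem inl_notMem_cycleNodes (s : Fin 1) : Sum.inl s ∉ cycleNodes hn := by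
  simp [cycleNodes, stateNode]

theorem isStemFrom_stemList : (stemCycle n).IsStemFrom 0 (stemList hn) := by
  have h1 := armLength_pos n
  have h2 := two_mul_armLength_lt hn
  refine ⟨?_, ?_, rfl, ?_⟩
  · rw [stemList, List.nodup_cons, List.nodup_cons]
    refine ⟨by simp [stateNode], ?_, ?_⟩
    · simp only [List.mem_map, List.mem_range'_1, not_exists, not_and]
      intro k hk h
      have := stateNode_injOn hn (by omega) (by omega) h
      omega
    · refine List.Nodup.map_on ?_ List.nodup_range'
      intro j hj k hk h
      rw [List.mem_range'_1] at hj hk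
      exact stateNode_injOn hn (by omega) (by omega) h
  · obtain ⟨r, hr⟩ := Nat.exists_eq_add_of_lt (show armLength n + 1 < n by omega)
    rw [stemList, show n - (armLength n + 1) = r + 1 by omega, List.range'_succ, List.map_cons,
      List.isChain_cons_cons, List.isChain_cons_cons, ← List.map_cons, ← List.range'_succ]
    refine ⟨by simp [stateNode, Network.Adj, stemCycle], ?_, ?_⟩
    · exact (adj_stateNode hn (by omega) (by omega)).2 (Or.inr (Or.inl ⟨rfl, rfl⟩))
    · rw [List.isChain_iff_getElem]
      intro k hk
      simp only [List.length_map, List.length_range'] at hk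
      simp only [List.getElem_map, List.getElem_range', one_mul]
      exact (adj_stateNode hn (by omega) (by omega)).2 (Or.inl ⟨by omega, by omega⟩)
  · obtain ⟨r, hr⟩ := Nat.exists_eq_add_of_lt (show armLength n + 1 < n by omega)
    rw [stemList, show n - (armLength n + 1) = r + 1 by omega, List.range'_concat]
    exact ⟨_, by simp [stateNode, List.getLast?_cons]; rfl⟩

theorem isCycle_cycleNodes : (stemCycle n).IsCycle (cycleNodes hn) := by
  have h1 := armLength_pos n
  have h2 := two_mul_armLength_lt hn
  refine ⟨?_, ?_, ?_⟩
  · intro h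
    have := (inr_mem_cycleNodes hn ⟨0, by omega⟩).2 (Nat.zero_le _)
    rw [h] at this
    exact Cycle.notMem_nil _ this
  · refine List.Nodup.map_on ?_ List.nodup_range
    intro j hj k hk h
    rw [List.mem_range] at hj hk
    exact stateNode_injOn hn (by omega) (by omega) h
  · rw [cycleNodes, cycle_coe_map_range_eq _ (Nat.succ_pos _), Cycle.chain_coe_cons]
    -- The closed walk is listed with the center repeated at the end, so the closing edge is one
    -- more consecutive pair.
    have h : stateNode hn 0 :: (((List.range' (0 + 1) (armLength n + 1 - (0 + 1))).map
        (stateNode hn) ++ (List.range 0).map (stateNode hn)) ++ [stateNode hn 0]) =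
          (List.range (armLength n + 1) ++ [0]).map (stateNode hn) := by
      rw [List.range_eq_range' (n := armLength n + 1), List.range'_succ]
      simp
    rw [h, List.isChain_iff_getElem]
    intro k hk
    simp only [List.length_map, List.length_append, List.length_range, List.length_singleton] at hk
    simp only [List.getElem_map, List.getElem_append, List.getElem_range, List.length_range,
      List.getElem_singleton]
    refine (adj_stateNode hn ?_ ?_).2 ?_ <;> split_ifs <;> omega

theorem stemCycle_isStemCycleAt : (stemCycle n).IsStemCycleAt ⟨0, by omega⟩ := by
  have h1 := armLength_pos n
  have h2 := two_mul_armLength_lt hn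
  refine ⟨stemList hn, cycleNodes hn, ⟨0, isStemFrom_stemList hn⟩, isCycle_cycleNodes hn,
    ?_, ?_, ?_⟩
  · rintro (s | i)
    · exact Or.inl (inl_mem_stemList hn s)
    · rw [inr_mem_stemList, inr_mem_cycleNodes]
      omega
  · obtain ⟨r, hr⟩ := Nat.exists_eq_add_of_lt (show armLength n + 1 < n by omega)
    rintro (s | j) (t | i) h
    · exact h.elim
    · obtain rfl := Subsingleton.elim s 0
      have hi : (i : ℕ) = 0 := h
      rw [← stateNode_val hn, hi]
      exact Or.inl ⟨[], _, rfl⟩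
    · exact h.elim
    · have hi := i.2
      rw [← stateNode_val hn i, ← stateNode_val hn j] at h ⊢
      rcases (adj_stateNode hn j.2 i.2).1 h with ⟨h, h'⟩ | ⟨hj, hi'⟩ | ⟨hj, hi'⟩
      · rw [h]
        rcases Nat.lt_or_ge j (armLength n) with hj | hj
        · refine Or.inr ⟨_, cycle_coe_map_range_eq _ (by omega), ?_⟩
          obtain ⟨k, hk⟩ := Nat.exists_eq_add_of_lt hj
          rw [show armLength n + 1 - ((j : ℕ) + 1) = k + 1 by omega, List.range'_succ]
          rfl
        · obtain ⟨k, hk⟩ := Nat.exists_eq_add_of_le (show armLength n + 1 ≤ j by omega)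
          rw [hk]
          exact Or.inl ((pair_infix_map_range' (stateNode hn) (l := n - (armLength n + 1))
            (by omega)).trans
            ⟨[Sum.inl 0, stateNode hn 0], [], by simp [stemList]⟩)
      · rw [hj, hi']
        refine Or.inl ⟨[Sum.inl 0], (List.range' (armLength n + 2) r).map (stateNode hn), ?_⟩
        rw [stemList, show n - (armLength n + 1) = r + 1 by omega, List.range'_succ]
        rfl
      · rw [hj, hi']
        refine Or.inr ⟨_, cycle_coe_map_range_eq _ (Nat.lt_succ_self _), ?_⟩
        rw [Nat.sub_self, ← Nat.succ_pred_eq_of_pos h1, List.range_succ_eq_map]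
        rfl
  · rintro (s | i)
    · simp [inl_notMem_cycleNodes]
    · rw [inr_mem_stemList, inr_mem_cycleNodes, Sum.inr.injEq, Fin.ext_iff]
      simp only
      omega

end Graph

theorem stemCycle_isXNetwork {n : ℕ} (hn : 3 ≤ n) : (stemCycle n).IsXNetwork := by
  obtain ⟨p, c, hp, hc, hcov, -, hz⟩ := stemCycle_isStemCycleAt hn
  refine ⟨stemCycle_inputAccessible n, stemCycle_not_structurallyControllable hn, {p}, {c},
    by simpa using hp, by simpa using hc, fun i => ?_, Or.inl ?_, ?_⟩
  · simpa using hcov (Sum.inr i)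
  · exact ⟨p, rfl, c, rfl, _, (hz _).2 rfl⟩
  · rintro ⟨p, rfl, p', rfl, h, -⟩
    exact h rfl

/-- Nonemptiness matters here: `sInf ∅ = 0` in `ℕ` would make the minimum meaningless. -/
theorem stemCycle_minFirstOrder_isLeast {n : ℕ} (hn : 3 ≤ n) :
    IsLeast (stemCycle n).firstOrderCounts (stemCycle n).minFirstOrder :=
  ⟨Nat.sInf_mem ⟨_, Finset.univ, rfl, stemCycle_structurallyOutputControllable_univ hn⟩,
    fun _ hk => Nat.sInf_le hk⟩

theorem doubledCenter_higherOrderCount {n : ℕ} (hn : 3 ≤ n) :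
    (doubledCenter n).higherOrderCount = 1 := by
  rw [LocalDynamics.higherOrderCount, Finset.card_eq_one]
  refine ⟨⟨0, by omega⟩, Finset.ext fun i => ?_⟩
  rw [Finset.mem_filter, Finset.mem_singleton, Fin.ext_iff]
  simp only [doubledCenter, Finset.mem_univ, true_and]
  split_ifs with h <;> simp [h]

end NetCtrl

theorem corollary3 :
    ∃ (N : ∀ n : ℕ, NetCtrl.Network n 1) (D : ∀ n : ℕ, NetCtrl.LocalDynamics n),
      (∀ n : ℕ, 3 ≤ n →
        (N n).IsXNetwork ∧
        (∃ z : Fin n, (N n).IsStemCycleAt z ∧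
          (D n).order z = 2 ∧ ∀ i, i ≠ z → (D n).order i = 1) ∧
        (D n).Homogeneous ∧
        (D n).higherOrderCount = 1 ∧
        (N n).StructurallyOutputControllable (D n) ∧
        IsLeast (N n).firstOrderCounts (N n).minFirstOrder) ∧
      Filter.Tendsto (fun n : ℕ => (N n).advantage (D n)) Filter.atTop Filter.atTop := by
  refine ⟨NetCtrl.stemCycle, NetCtrl.doubledCenter, fun n hn =>
    ⟨NetCtrl.stemCycle_isXNetwork hn,
      ⟨⟨0, by omega⟩, NetCtrl.stemCycle_isStemCycleAt hn, rfl,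
        fun i hi => if_neg fun h => hi (Fin.ext h)⟩,
      rfl, NetCtrl.doubledCenter_higherOrderCount hn,
      NetCtrl.stemCycle_structurallyOutputControllable_doubledCenter hn,
      NetCtrl.stemCycle_minFirstOrder_isLeast hn⟩, ?_⟩
  -- For n ≥ 3 this is a lower bound for the advantage, so the exact value of S is not required.
  have h : Filter.Tendsto (fun n => (NetCtrl.armLength n : ℤ) + -1) Filter.atTop Filter.atTop :=
    Filter.tendsto_atTop_add_const_right _ _
      (tendsto_natCast_atTop_atTop.comp NetCtrl.tendsto_armLength)
  refine Filter.tendsto_atTop_mono' _ (Filter.eventually_atTop.2 ⟨3, fun n hn => ?_⟩) h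
  have h' := NetCtrl.armLength_le_of_mem_firstOrderCounts hn
    (NetCtrl.stemCycle_minFirstOrder_isLeast hn).1
  simp only [NetCtrl.Network.advantage]
  rw [NetCtrl.doubledCenter_higherOrderCount hn]
  push_cast
  omega
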